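/- There exist absolute constants $c>0$ and $\varepsilon_0\in(0,1)$ such that for every fixed $\varepsilon$ with $0<\varepsilon<\varepsilon_0$ the following holds. Let $G(n,p)$ be the binomial random graph on $n$ labelled vertices, in which each of the $\binom n2$ possible edges is present independently with probability $p=\frac{1+\varepsilon}{n}$. Then $$\lim_{n\to\infty}\Pr\left(\mathrm{tw}\big(G(n,p)\big)\ \ge\ c\,\frac{\varepsilon^{3}}{\log(1/\varepsilon)}\,n\right)=1,$$ where $\log$ is the natural logarithm and $\mathrm{tw}(G)$ is the tree-width of $G$: the minimum of $\max_{x\in V(T)}(|V_x|-1)$ over all pairs consisting of a finite tree $T$ and a family $(V_x)_{x\in V(T)}$ of subsets of $V(G)$ such that, for every vertex $v$ of $G$, the set $\{x : v\in V_x\}$ induces a non-empty subtree of $T$, and every edge of $G$ has both endpoints in some $V_x$. -/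

import Mathlib

open Filter Topology

/-- A tree-decomposition of a graph `G`: a finite tree `tree` on a set `Node` of nodes, and a
bag of vertices of `G` for every node, such that for every vertex `v` the nodes whose bags contain
`v` induce a nonempty subtree, and every edge of `G` is contained in some bag.
(`SimpleGraph.Connected` includes nonemptiness, and a connected induced subgraph of a tree is a
subtree.) -/
structure TreeDecomposition {V : Type*} (G : SimpleGraph V) where
  Node : Type
  finite_node : Finite Node
  tree : SimpleGraph Node
  isTree : tree.IsTree
  bag : Node → Finset V
  connected_induce : ∀ v : V, (tree.induce {x : Node | v ∈ bag x}).Connected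
  exists_bag : ∀ u v : V, G.Adj u v → ∃ x : Node, u ∈ bag x ∧ v ∈ bag x

/-- The width of a tree-decomposition, `max {|bag x| - 1}` over all nodes `x`.
It is an integer: it is `-1` exactly if all bags are empty. -/
noncomputable def TreeDecomposition.width {V : Type*} {G : SimpleGraph V}
    (D : TreeDecomposition G) : ℤ :=
  ⨆ x : D.Node, (((D.bag x).card : ℤ) - 1)

/-- The tree-width of a finite graph: the minimum width over all its tree-decompositions. -/
noncomputable def treeWidth {V : Type*} [Finite V] (G : SimpleGraph V) : ℤ :=
  sInf (Set.range fun D : TreeDecomposition G => D.width)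

/-- The set of widths has a least element, so the infimum in `treeWidth` is a minimum. -/
theorem treeWidth_isLeast {V : Type*} [Finite V] (G : SimpleGraph V) :
    IsLeast (Set.range fun D : TreeDecomposition G => D.width) (treeWidth G) := by
  classical
  have := Fintype.ofFinite V
  have hne : (Set.range fun D : TreeDecomposition G => D.width).Nonempty := by
    refine ⟨_, ⟨⟨Unit, inferInstance, ⊥, SimpleGraph.IsTree.of_subsingleton,
      fun _ => Finset.univ, fun v => ?_, fun u v _ => ⟨(), by simp, by simp⟩⟩, rfl⟩⟩
    have hn : Nonempty {x : Unit | v ∈ (Finset.univ : Finset V)} := ⟨⟨(), by simp⟩⟩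
    exact SimpleGraph.IsTree.of_subsingleton.connected
  have hbd : BddBelow (Set.range fun D : TreeDecomposition G => D.width) := by
    refine ⟨-1, ?_⟩
    rintro _ ⟨D, rfl⟩
    have := D.finite_node
    obtain ⟨x⟩ := D.isTree.connected.nonempty
    have h := le_ciSup (Set.finite_range
      (fun x : D.Node => (((D.bag x).card : ℤ) - 1))).bddAbove x
    change -1 ≤ ⨆ x : D.Node, (((D.bag x).card : ℤ) - 1)
    refine le_trans ?_ h
    omega
  exact ⟨Int.csInf_mem hne hbd, fun w hw => csInf_le hbd hw⟩

/-! The proof is by sprinkling. Write `G(n, p)` as a union of independent graphs `H = G(n, p₁)` and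
`G(n, p₂)`, with `p₁ = (1 + ε/2)/n` and `p₂ ≥ ε/(2n)` (`map_sup_binomialRandom`). Exploring `H`
vertex by vertex, a Chernoff bound shows that the active set is nonempty throughout a time interval
of length about `εn/8`, so with high probability `H` has a component `L` with at least `εn/9`
vertices (`binomialRandom_no_linear_component_le`).

If the tree-width of the union is below `K = cε³n/log(1/ε)`, some bag `S` of at most `k ≤ K + 1`
vertices splits `L \ S` into sets `A`, `B` of at least `|L|/8` vertices each with no edge between
them (`TreeDecomposition.exists_balanced_separator`). For fixed `A`, `B` the sprinkled edges all
miss `A × B` with probability at most `exp(-p₂|L|²/64)`, which is `exp(-Ω(ε³n))`.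

It remains to count the pairs `(S, A)`. There are at most `exp(4k log(1/ε) + ε⁴n)` sets `S`, and
this entropy is the source of the logarithm. Naively there would be exponentially many in `εn`
choices of `A`, which is too many; but `A` is a union of components of `H[L \ S]`, and since `L` is
connected in `H`, it is determined by its trace on the outer boundary of `S`
(`card_separatedParts_le`). Averaged over `H`, this leaves at most `(1 + p₁)^(kn) ≤ exp(2k)` choices
(`integral_two_pow_card_outerBoundary_le`). For small `c` the union bound tends to zero. -/

/-! ### Edge independence and sprinkling in the binomial random graph. -/

open MeasureTheory ProbabilityTheory in
/-- Every set of graphs on a finite vertex set is measurable. -/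
instance SimpleGraph.instDiscreteMeasurableSpace {V : Type*} [Finite V] :
    DiscreteMeasurableSpace (SimpleGraph V) := by
  have : MeasurableSingletonClass (SimpleGraph V) := ⟨fun G => by
    have h : ({G} : Set (SimpleGraph V)) =
        ⋂ (u : V) (v : V), {H : SimpleGraph V | H.Adj u v ↔ G.Adj u v} := by
      ext H
      simp only [Set.mem_singleton_iff, Set.mem_iInter, Set.mem_ofPred_eq]
      exact ⟨fun h => by simp [h], fun h => by ext u v; exact h u v⟩
    rw [h]
    have := SimpleGraph.measurable_iff_adj.1 (measurable_id (α := SimpleGraph V))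
    exact MeasurableSet.iInter fun u => MeasurableSet.iInter fun v =>
      ((this u v).iff measurable_const).setOf⟩
  exact MeasurableSingletonClass.toDiscreteMeasurableSpace

namespace SimpleGraph

open MeasureTheory ProbabilityTheory unitInterval

variable {V : Type*}

/-- The pushforward of the product measure under which `binomialRandom` is the law of the graph. -/
theorem binomialRandom_eq_map_infinitePi [Finite V] (p : I) :
    binomialRandom V p = (Measure.infinitePi fun e : Sym2 V =>
      toNNReal p • .dirac (e ∈ (Sym2.diagSetᶜ : Set (Sym2 V))) + toNNReal (σ p) • .dirac False).map
        (fun q : Sym2 V → Prop => fromEdgeSet {e | q e}) := by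
  rw [binomialRandom_eq_map, setBernoulli_eq_map,
    Measure.map_map measurable_fromEdgeSet (by fun_prop)]
  rfl

theorem iIndepFun_mem_edgeSet [Finite V] (p : I) :
    iIndepFun (fun (e : Sym2 V) (G : SimpleGraph V) => e ∈ G.edgeSet) (binomialRandom V p) := by
  have h0 := (iIndepFun_infinitePi (P := fun e : Sym2 V => toNNReal p • Measure.dirac
    (e ∈ (Sym2.diagSetᶜ : Set (Sym2 V))) + toNNReal (σ p) • .dirac False)
    (X := fun _ => id) (fun _ => measurable_id)).comp
      (fun e q => q ∧ ¬ e.IsDiag) (fun e => .of_discrete)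
  rw [binomialRandom_eq_map_infinitePi]
  rw [iIndepFun_iff_measure_inter_preimage_eq_mul] at h0 ⊢
  have hmeas : Measurable (fun q : Sym2 V → Prop => fromEdgeSet {e | q e}) :=
    measurable_fromEdgeSet.comp (by fun_prop)
  intro S sets hS
  have := h0 S (sets := sets) hS
  rw [Measure.map_apply hmeas .of_discrete]
  simp_rw [Measure.map_apply hmeas (MeasurableSet.of_discrete)]
  convert this using 2 with e he
  · ext q
    simp [Function.comp_def]
  · congr 1
    ext q
    simp [Function.comp_def]

theorem binomialRandom_mem_edgeSet [Finite V] (p : I) {e : Sym2 V} (he : ¬ e.IsDiag) :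
    (binomialRandom V p).real {G | e ∈ G.edgeSet} = p := by
  have hmeas : Measurable (fun q : Sym2 V → Prop => fromEdgeSet {e | q e}) :=
    measurable_fromEdgeSet.comp (by fun_prop)
  have h := congrArg (fun μ : Measure Prop => μ {True}) (Measure.infinitePi_map_eval
    (fun e : Sym2 V => toNNReal p • Measure.dirac
    (e ∈ (Sym2.diagSetᶜ : Set (Sym2 V))) + toNNReal (σ p) • .dirac False) e)
  rw [Measure.map_apply (by fun_prop) .of_discrete] at h
  rw [binomialRandom_eq_map_infinitePi, measureReal_def,
    Measure.map_apply hmeas .of_discrete]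
  have hs : (fun q : Sym2 V → Prop => fromEdgeSet {e | q e}) ⁻¹' {G | e ∈ G.edgeSet} =
      (fun q => q e) ⁻¹' {True} := by
    ext q
    simp [he]
  rw [hs, h]
  simp [he]

/-- An edge is independent of every event that does not depend on it. -/
theorem binomialRandom_mem_edgeSet_inter [Finite V] (p : I) {e : Sym2 V} (he : ¬ e.IsDiag)
    {E : Set (SimpleGraph V)}
    (hE : ∀ G G' : SimpleGraph V, (∀ f, f ≠ e → (f ∈ G.edgeSet ↔ f ∈ G'.edgeSet)) →
      G ∈ E → G' ∈ E) :
    (binomialRandom V p).real ({G | e ∈ G.edgeSet} ∩ E) =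
      p * (binomialRandom V p).real E := by
  classical
  have := Fintype.ofFinite V
  have hind := (iIndepFun_mem_edgeSet (V := V) p).indepFun_finset {e} (Finset.univ.erase e)
    (by simp) (fun _ => .of_discrete)
  rw [indepFun_iff_measure_inter_preimage_eq_mul] at hind
  have := hind {q | q ⟨e, by simp⟩} ((fun (G : SimpleGraph V) (i : (Finset.univ.erase e :
    Finset (Sym2 V))) => i.1 ∈ G.edgeSet) '' E) (Set.toFinite _).measurableSet
      (Set.toFinite _).measurableSet
  -- Invariance under changing `e` makes `E` saturated for restriction to the other pairs, hence an
  -- event in those coordinates alone.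
  have h1 : (fun (G : SimpleGraph V) (i : (Finset.univ.erase e :
    Finset (Sym2 V))) => i.1 ∈ G.edgeSet) ⁻¹' ((fun (G : SimpleGraph V) (i : (Finset.univ.erase e :
    Finset (Sym2 V))) => i.1 ∈ G.edgeSet) '' E) = E := by
    refine subset_antisymm ?_ (Set.subset_preimage_image _ _)
    rintro G ⟨G', hG', hGG'⟩
    refine hE G' G (fun f hf => ?_) hG'
    simpa using congrFun hGG' ⟨f, by simp [hf]⟩
  have h2 : (fun (G : SimpleGraph V) (i : ({e} : Finset (Sym2 V))) => i.1 ∈ G.edgeSet) ⁻¹'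
      {q | q ⟨e, by simp⟩} = {G | e ∈ G.edgeSet} := rfl
  rw [h1, h2] at this
  rw [measureReal_def, this, ENNReal.toReal_mul, ← measureReal_def, ← measureReal_def,
    binomialRandom_mem_edgeSet p he]

theorem binomialRandom_notMem_edgeSet_inter [Finite V] (p : I) {e : Sym2 V} (he : ¬ e.IsDiag)
    {E : Set (SimpleGraph V)}
    (hE : ∀ G G' : SimpleGraph V, (∀ f, f ≠ e → (f ∈ G.edgeSet ↔ f ∈ G'.edgeSet)) →
      G ∈ E → G' ∈ E) :
    (binomialRandom V p).real ({G | e ∉ G.edgeSet} ∩ E) =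
      (1 - p) * (binomialRandom V p).real E := by
  have h := measureReal_inter_add_sdiff (μ := binomialRandom V p) (s := E)
    (t := {G | e ∈ G.edgeSet}) .of_discrete
  rw [Set.inter_comm, binomialRandom_mem_edgeSet_inter p he hE] at h
  have h' : ({G | e ∉ G.edgeSet} ∩ E) = E \ {G | e ∈ G.edgeSet} := by
    ext; simp [and_comm]
  rw [h']
  linarith

/-- Prescribing the random graph on a set `A` of possible edges is independent of every event that
does not depend on `A`. -/
theorem binomialRandom_pattern_inter [Finite V] [DecidableEq V] (p : I) (A B : Finset (Sym2 V))
    (hA : ∀ e ∈ A, ¬ e.IsDiag) {E : Set (SimpleGraph V)}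
    (hE : ∀ G G' : SimpleGraph V, (∀ f, f ∉ A → (f ∈ G.edgeSet ↔ f ∈ G'.edgeSet)) →
      G ∈ E → G' ∈ E) :
    (binomialRandom V p).real ({G | ∀ e ∈ A, (e ∈ G.edgeSet ↔ e ∈ B)} ∩ E) =
      p ^ (A ∩ B).card * (1 - p) ^ (A \ B).card * (binomialRandom V p).real E := by
  induction A using Finset.induction_on with
  | empty => simp
  | insert e A heA ih =>
    have hdiag := hA e (by simp)
    specialize ih (fun f hf => hA f (by simp [hf])) (fun G G' h => hE G G' fun f hf => h f fun h' =>
      hf (by simp [h']))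
    have hinv : ∀ G G' : SimpleGraph V, (∀ f, f ≠ e → (f ∈ G.edgeSet ↔ f ∈ G'.edgeSet)) →
        G ∈ {G | ∀ e ∈ A, (e ∈ G.edgeSet ↔ e ∈ B)} ∩ E →
        G' ∈ {G : SimpleGraph V | ∀ e ∈ A, (e ∈ G.edgeSet ↔ e ∈ B)} ∩ E := by
      rintro G G' h ⟨h1, h2⟩
      refine ⟨fun f hf => ?_, hE G G' (fun f hf => h f ?_) h2⟩
      · rw [← h f (fun hfe => heA (hfe ▸ hf)), h1 f hf]
      · rintro rfl
        exact hf (by simp)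
    by_cases heB : e ∈ B
    · have hset : {G : SimpleGraph V | ∀ f ∈ insert e A, (f ∈ G.edgeSet ↔ f ∈ B)} ∩ E =
          {G | e ∈ G.edgeSet} ∩ ({G | ∀ e ∈ A, (e ∈ G.edgeSet ↔ e ∈ B)} ∩ E) := by
        ext G
        simp [heB, and_assoc]
      rw [hset, binomialRandom_mem_edgeSet_inter p hdiag hinv, ih,
        Finset.insert_inter_of_mem heB, Finset.insert_sdiff_of_mem _ heB,
        Finset.card_insert_of_notMem (by simp [heA])]
      ring
    · have hset : {G : SimpleGraph V | ∀ f ∈ insert e A, (f ∈ G.edgeSet ↔ f ∈ B)} ∩ E =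
          {G | e ∉ G.edgeSet} ∩ ({G | ∀ e ∈ A, (e ∈ G.edgeSet ↔ e ∈ B)} ∩ E) := by
        ext G
        simp [heB, and_assoc]
      rw [hset, binomialRandom_notMem_edgeSet_inter p hdiag hinv, ih,
        Finset.insert_inter_of_notMem heB, Finset.insert_sdiff_of_notMem _ heB,
        Finset.card_insert_of_notMem (by simp [heA])]
      ring

theorem binomialRandom_forall_mem_edgeSet [Finite V] (p : I) (A : Finset (Sym2 V))
    (hA : ∀ e ∈ A, ¬ e.IsDiag) :
    (binomialRandom V p).real {G | ∀ e ∈ A, e ∈ G.edgeSet} = p ^ A.card := by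
  classical
  have := binomialRandom_pattern_inter p A A hA (E := Set.univ) (by simp)
  rw [Set.inter_univ] at this
  simpa +contextual using this

theorem binomialRandom_forall_notMem_edgeSet [Finite V] (p : I) (A : Finset (Sym2 V))
    (hA : ∀ e ∈ A, ¬ e.IsDiag) :
    (binomialRandom V p).real {G | ∀ e ∈ A, e ∉ G.edgeSet} = (1 - p) ^ A.card := by
  classical
  have := binomialRandom_pattern_inter p A ∅ hA (E := Set.univ) (by simp)
  rw [Set.inter_univ] at this
  simpa using this

/-- The union of two independent binomial random graphs is a binomial random graph. -/
theorem map_sup_binomialRandom [Finite V] {p p₁ p₂ : I}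
    (hp : 1 - (p : ℝ) = (1 - p₁) * (1 - p₂)) :
    ((binomialRandom V p₁).prod (binomialRandom V p₂)).map (fun x => x.1 ⊔ x.2) =
      binomialRandom V p := by
  classical
  have := Fintype.ofFinite V
  let S : Finset (Sym2 V) → Set (SimpleGraph V) := fun A => {G | ∀ e ∈ A, e ∉ G.edgeSet}
  let C : Set (Set (SimpleGraph V)) := {s | ∃ A : Finset (Sym2 V), (∀ e ∈ A, ¬ e.IsDiag) ∧ S A = s}
  have hmeas : Measurable (fun x : SimpleGraph V × SimpleGraph V => x.1 ⊔ x.2) := .of_discrete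
  have : IsProbabilityMeasure
      (((binomialRandom V p₁).prod (binomialRandom V p₂)).map (fun x => x.1 ⊔ x.2)) :=
    Measure.isProbabilityMeasure_map hmeas.aemeasurable
  -- The events "no edge in `A`" form a π-system generating all sets of graphs, and on them a union
  -- of graphs turns into a product of probabilities.
  refine ext_of_generate_finite C ?_ ?_ ?_ (by simp)
  · refine le_antisymm (fun s _ => ?_) (fun s _ => .of_discrete)
    have hsing : ∀ G : SimpleGraph V, MeasurableSet[MeasurableSpace.generateFrom C] {G} := by
      intro G
      have hG : ({G} : Set (SimpleGraph V)) =
          S (Finset.univ.filter fun e => ¬ e.IsDiag ∧ e ∉ G.edgeSet) \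
            ⋃ e ∈ Finset.univ.filter (· ∈ G.edgeSet), S {e} := by
        ext H
        simp only [Set.mem_singleton_iff, S, Set.mem_sdiff, Set.mem_iUnion, Set.mem_ofPred_eq,
          Finset.mem_filter, Finset.mem_univ, true_and, Finset.mem_singleton, forall_eq]
        constructor
        · rintro rfl
          simp +contextual
        · rintro ⟨h1, h2⟩
          push Not at h2
          rw [← edgeSet_inj]
          ext e
          refine ⟨fun he => ?_, h2 e⟩
          by_contra hc
          exact h1 e ⟨not_isDiag_of_mem_edgeSet _ he, hc⟩ he
      rw [hG]
      refine MeasurableSet.diff (MeasurableSpace.measurableSet_generateFrom ⟨_, by simp +contextual, rfl⟩)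
        (Finset.measurableSet_biUnion _ fun e he =>
          MeasurableSpace.measurableSet_generateFrom ⟨_, ?_, rfl⟩)
      simp only [Finset.mem_filter, Finset.mem_univ, true_and] at he
      simpa using not_isDiag_of_mem_edgeSet _ he
    rw [← Set.biUnion_of_singleton s]
    exact MeasurableSet.biUnion (Set.to_countable s) fun G _ => hsing G
  · rintro _ ⟨A, hA, rfl⟩ _ ⟨B, hB, rfl⟩ -
    refine ⟨A ∪ B, fun e he => ?_, ?_⟩
    · rcases Finset.mem_union.1 he with h | h
      exacts [hA e h, hB e h]
    · ext G
      simp only [S, Finset.mem_union, Set.mem_inter_iff, Set.mem_ofPred_eq, or_imp, forall_and]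
  · rintro _ ⟨A, hA, rfl⟩
    rw [← ENNReal.toReal_eq_toReal_iff' (measure_ne_top _ _) (measure_ne_top _ _),
      Measure.map_apply hmeas .of_discrete]
    have : (fun x : SimpleGraph V × SimpleGraph V => x.1 ⊔ x.2) ⁻¹' S A = S A ×ˢ S A := by
      ext x
      simp [S, forall_and]
    rw [this, Measure.prod_prod, ENNReal.toReal_mul]
    have h := fun q => binomialRandom_forall_notMem_edgeSet (V := V) q A hA
    simp only [measureReal_def] at h
    rw [h, h, h, hp, mul_pow]

end SimpleGraph

/-! ### Exploration of components and a Chernoff bound for it. -/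

namespace SimpleGraph

open MeasureTheory ProbabilityTheory unitInterval

section Exploration

variable {V : Type*} [Nonempty V]

/-- The next vertex to be processed by the exploration with active set `s.1` and untouched set
`s.2`: an active vertex if there is one, and an untouched one otherwise. -/
noncomputable def exploreVertex (s : Finset V × Finset V) : V :=
  if h : s.1.Nonempty then h.choose else if h : s.2.Nonempty then h.choose
    else Classical.arbitrary V

theorem exploreVertex_mem_fst {s : Finset V × Finset V} (h : s.1.Nonempty) :
    exploreVertex s ∈ s.1 := by
  rw [exploreVertex, dif_pos h]
  exact h.choose_spec

variable [DecidableEq V]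

/-- The state of the exploration after its next vertex was found to have the neighbours `R` among
the untouched vertices. -/
noncomputable def exploreWith (s : Finset V × Finset V) (R : Finset V) : Finset V × Finset V :=
  (s.1.erase (exploreVertex s) ∪ R, s.2.erase (exploreVertex s) \ R)

open scoped Classical in
/-- The untouched neighbours of the next vertex of the exploration. -/
noncomputable def exploreNeighbors (G : SimpleGraph V) (s : Finset V × Finset V) : Finset V :=
  (s.2.erase (exploreVertex s)).filter (G.Adj (exploreVertex s))

/-- One step of the exploration of the components of `G`: an active vertex (or, if there is none,
an untouched one) is processed, and its untouched neighbours become active. -/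
noncomputable def exploreStep (G : SimpleGraph V) (s : Finset V × Finset V) :
    Finset V × Finset V :=
  exploreWith s (exploreNeighbors G s)

theorem exploreVertex_mem {s : Finset V × Finset V} (h : (s.1 ∪ s.2).Nonempty) :
    exploreVertex s ∈ s.1 ∪ s.2 := by
  by_cases h1 : s.1.Nonempty
  · exact Finset.mem_union_left _ (exploreVertex_mem_fst h1)
  · have h2 : s.2.Nonempty := by
      rw [Finset.union_nonempty] at h
      exact h.resolve_left h1
    rw [exploreVertex, dif_neg h1, dif_pos h2]
    exact Finset.mem_union_right _ h2.choose_spec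

theorem mem_exploreNeighbors {G : SimpleGraph V} {s : Finset V × Finset V} {v : V} :
    v ∈ exploreNeighbors G s ↔
      v ≠ exploreVertex s ∧ v ∈ s.2 ∧ G.Adj (exploreVertex s) v := by
  simp [exploreNeighbors, and_assoc]

theorem exploreNeighbors_subset (G : SimpleGraph V) (s : Finset V × Finset V) :
    exploreNeighbors G s ⊆ s.2.erase (exploreVertex s) := by
  classical exact Finset.filter_subset _ _

theorem union_exploreWith {s : Finset V × Finset V} {R : Finset V}
    (hR : R ⊆ s.2.erase (exploreVertex s)) :
    (exploreWith s R).1 ∪ (exploreWith s R).2 = (s.1 ∪ s.2).erase (exploreVertex s) := by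
  ext v
  have := @hR v
  simp only [exploreWith, Finset.mem_union, Finset.mem_erase, Finset.mem_sdiff] at *
  tauto

theorem disjoint_exploreWith {s : Finset V × Finset V} (hs : Disjoint s.1 s.2) (R : Finset V) :
    Disjoint (exploreWith s R).1 (exploreWith s R).2 := by
  rw [Finset.disjoint_left] at *
  intro v
  have := @hs v
  simp only [exploreWith, Finset.mem_union, Finset.mem_erase, Finset.mem_sdiff] at *
  tauto

theorem exploreStep_congr {G G' : SimpleGraph V} {s : Finset V × Finset V}
    (h : ∀ u ∈ s.1 ∪ s.2, ∀ v ∈ s.1 ∪ s.2, (G.Adj u v ↔ G'.Adj u v)) :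
    exploreStep G s = exploreStep G' s := by
  have : exploreNeighbors G s = exploreNeighbors G' s := by
    ext v
    simp only [mem_exploreNeighbors]
    refine and_congr_right fun _ => and_congr_right fun hv => ?_
    have hv' := Finset.mem_union_right s.1 hv
    exact h _ (exploreVertex_mem ⟨v, hv'⟩) _ hv'
  rw [exploreStep, exploreStep, this]

theorem union_exploreStep (G : SimpleGraph V) (s : Finset V × Finset V) :
    (exploreStep G s).1 ∪ (exploreStep G s).2 = (s.1 ∪ s.2).erase (exploreVertex s) :=
  union_exploreWith (exploreNeighbors_subset G s)

/-- A processed vertex leaves both sets, so the future of the exploration never queries its edges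
again. This is the source of independence between steps. -/
theorem exploreStep_iterate_congr {G G' : SimpleGraph V} (k : ℕ) {s : Finset V × Finset V}
    (h : ∀ u ∈ s.1 ∪ s.2, ∀ v ∈ s.1 ∪ s.2, (G.Adj u v ↔ G'.Adj u v)) :
    (exploreStep G)^[k] s = (exploreStep G')^[k] s := by
  induction k generalizing s with
  | zero => rfl
  | succ k ih =>
    rw [Function.iterate_succ_apply, Function.iterate_succ_apply, ← exploreStep_congr h]
    refine ih fun u hu v hv => ?_
    rw [union_exploreStep] at hu hv
    exact h u (Finset.mem_of_mem_erase hu) v (Finset.mem_of_mem_erase hv)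

theorem exploreStep_iterate_snd_subset (G : SimpleGraph V) (k : ℕ) (s : Finset V × Finset V) :
    ((exploreStep G)^[k] s).2 ⊆ s.2 := by
  induction k generalizing s with
  | zero => rfl
  | succ k ih =>
    rw [Function.iterate_succ_apply]
    exact (ih _).trans (Finset.sdiff_subset.trans (Finset.erase_subset _ _))

theorem card_le_card_exploreStep_iterate (G : SimpleGraph V) (k : ℕ) (s : Finset V × Finset V) :
    (s.1 ∪ s.2).card ≤
      (((exploreStep G)^[k] s).1 ∪ ((exploreStep G)^[k] s).2).card + k := by
  induction k generalizing s with
  | zero => simp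
  | succ k ih =>
    rw [Function.iterate_succ_apply]
    have h1 := ih (exploreStep G s)
    rw [union_exploreStep] at h1
    have := Finset.pred_card_le_card_erase (s := s.1 ∪ s.2) (a := exploreVertex s)
    omega

theorem reachable_exploreStep {G : SimpleGraph V} {s : Finset V × Finset V}
    {r : V} (hu : G.Reachable r (exploreVertex s)) (hs : ∀ v ∈ s.1, G.Reachable r v) :
    ∀ v ∈ (exploreStep G s).1, G.Reachable r v := by
  intro v hv
  rcases Finset.mem_union.1 hv with h | h
  · exact hs v (Finset.mem_of_mem_erase h)
  · exact hu.trans (mem_exploreNeighbors.1 h).2.2.reachable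

/-- The exploration moves to an untouched start vertex only when nothing is active, so active
vertices of two components never coexist. -/
theorem reachable_exploreStep_iterate {G : SimpleGraph V} (k : ℕ) {s : Finset V × Finset V}
    (hs : ∀ u ∈ s.1, ∀ v ∈ s.1, G.Reachable u v) :
    ∀ u ∈ ((exploreStep G)^[k] s).1, ∀ v ∈ ((exploreStep G)^[k] s).1, G.Reachable u v := by
  induction k generalizing s with
  | zero => exact hs
  | succ k ih =>
    rw [Function.iterate_succ_apply]
    have h := reachable_exploreStep (G := G) (s := s) (Reachable.refl _)
      (fun v hv => hs _ (exploreVertex_mem_fst ⟨v, hv⟩) v hv)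
    exact ih fun u hu v hv => (h u hu).symm.trans (h v hv)

-- Every step taken with a nonempty active set removes one further vertex of the component of `r`.
open scoped Classical in
theorem le_card_filter_reachable {G : SimpleGraph V} (k : ℕ) {s : Finset V × Finset V} {r : V}
    (hr : ∀ v ∈ s.1, G.Reachable r v) (hk : ∀ j < k, ((exploreStep G)^[j] s).1.Nonempty) :
    k ≤ ((s.1 ∪ s.2).filter (G.Reachable r)).card := by
  induction k generalizing s with
  | zero => simp
  | succ k ih =>
    have hu := exploreVertex_mem_fst (hk 0 (by omega))
    rw [Function.iterate_zero_apply] at hu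
    have h := ih (s := exploreStep G s) (reachable_exploreStep (hr _ hu) hr) (fun j hj => by
      rw [← Function.iterate_succ_apply]
      exact hk (j + 1) (by omega))
    rw [union_exploreStep, Finset.filter_erase] at h
    have := Finset.card_erase_add_one (s := (s.1 ∪ s.2).filter (G.Reachable r))
      (a := exploreVertex s) (by simp [hu, hr _ hu])
    omega

/-- If the exploration has active vertices from time `a` until time `b`, then it spends this time
in one component. -/
theorem exists_le_ncard_reachable [Fintype V] {G : SimpleGraph V} {a b : ℕ}
    (h : ∀ j, a ≤ j → j < b → ((exploreStep G)^[j] (∅, Finset.univ)).1.Nonempty) :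
    ∃ r, b - a ≤ {v | G.Reachable r v}.ncard := by
  classical
  by_cases hab : a < b
  · obtain ⟨r, hr⟩ := h a le_rfl hab
    refine ⟨r, ?_⟩
    have h1 := le_card_filter_reachable (b - a)
      (reachable_exploreStep_iterate a (s := (∅, Finset.univ)) (G := G) (by simp) r hr)
      (fun j hj => by
        rw [← Function.iterate_add_apply]
        exact h _ (by omega) (by omega))
    refine h1.trans ?_
    rw [← Set.ncard_coe_finset]
    exact Set.ncard_le_ncard (fun v hv => by simp at hv; exact hv.2) (Set.toFinite _)
  · exact ⟨Classical.arbitrary V, by omega⟩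

/-- An exponential bound for the probability that the exploration runs out of active vertices at
time `k`. -/
theorem binomialRandom_exploreStep_iterate_le [Finite V] (p : I) {l : ℝ} (hl : 0 ≤ l) (m : ℕ)
    (k : ℕ) (s : Finset V × Finset V) (hs : Disjoint s.1 s.2) :
    (binomialRandom V p).real {G | ((exploreStep G)^[k] s).1 = ∅ ∧
        m ≤ ((exploreStep G)^[k] s).2.card} ≤
      Real.exp (l * (k - s.1.card)) * ((p * Real.exp (-l) + (1 - p)) ^ m) ^ k := by
  induction k generalizing s with
  | zero =>
    rcases s.1.eq_empty_or_nonempty with h | h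
    · simp [h, measureReal_le_one]
    · simp only [Function.iterate_zero, id, h.ne_empty, false_and, Set.ofPred_false,
        measureReal_empty]
      positivity
  | succ k ih =>
    set u := exploreVertex s with hu
    set T := s.2.erase u with hT
    have hp0 : (0 : ℝ) ≤ p := p.2.1
    have hp1 : (0 : ℝ) ≤ 1 - p := sub_nonneg.2 p.2.2
    have hq0 : 0 ≤ p * Real.exp (-l) + (1 - p) := by positivity
    have hq1 : p * Real.exp (-l) + (1 - p) ≤ 1 := by
      have : p * Real.exp (-l) ≤ p * 1 :=
        mul_le_mul_of_nonneg_left (Real.exp_le_one_iff.2 (by linarith)) hp0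
      linarith
    simp only [Function.iterate_succ_apply]
    -- The untouched set only shrinks, so with fewer than `m` vertices left in it the event is
    -- impossible.
    by_cases hTm : T.card < m
    · have : {G : SimpleGraph V | ((exploreStep G)^[k] (exploreStep G s)).1 = ∅ ∧
          m ≤ ((exploreStep G)^[k] (exploreStep G s)).2.card} = ∅ := by
        ext G
        simp only [Set.mem_ofPred_eq, Set.mem_empty_iff_false, iff_false, not_and, not_le]
        intro _
        refine lt_of_le_of_lt (Finset.card_le_card ?_) hTm
        exact (exploreStep_iterate_snd_subset G k _).trans Finset.sdiff_subset
      rw [this, measureReal_empty]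
      positivity
    push Not at hTm
    let E : Finset V → Set (SimpleGraph V) := fun R =>
      {G | ((exploreStep G)^[k] (exploreWith s R)).1 = ∅ ∧
        m ≤ ((exploreStep G)^[k] (exploreWith s R)).2.card}
    let A : Finset V → Finset (Sym2 V) := fun R => R.image fun t => s(u, t)
    have hinj : Function.Injective fun t => s(u, t) := fun t t' h => Sym2.congr_right.1 h
    let Q : Finset V → Set (SimpleGraph V) := fun R =>
      {G | ∀ e ∈ A T, (e ∈ G.edgeSet ↔ e ∈ A R)}
    have hAT : ∀ e ∈ A T, ¬ e.IsDiag := by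
      intro e he
      obtain ⟨t, ht, rfl⟩ := Finset.mem_image.1 he
      simpa using (Finset.ne_of_mem_erase ht).symm
    -- Split by the set `R` of newly found neighbours: `Q R` concerns only pairs at `u`, and `E R`
    -- only pairs avoiding `u`.
    have hsub : {G : SimpleGraph V | ((exploreStep G)^[k] (exploreStep G s)).1 = ∅ ∧
          m ≤ ((exploreStep G)^[k] (exploreStep G s)).2.card} ⊆
        ⋃ R ∈ T.powerset, Q R ∩ E R := by
      intro G hG
      simp only [Set.mem_iUnion]
      refine ⟨exploreNeighbors G s, Finset.mem_powerset.2 (exploreNeighbors_subset G s), ?_, hG⟩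
      intro e he
      obtain ⟨t, ht, rfl⟩ := Finset.mem_image.1 he
      rw [hinj.mem_finset_image, mem_exploreNeighbors, mem_edgeSet]
      have := Finset.mem_erase.1 ht
      tauto
    have hterm : ∀ R ∈ T.powerset, (binomialRandom V p).real (Q R ∩ E R) ≤
        (Real.exp (l * ((k + 1 : ℕ) - s.1.card)) * ((p * Real.exp (-l) + (1 - p)) ^ m) ^ k) *
          ((p * Real.exp (-l)) ^ R.card * (1 - p) ^ (T.card - R.card)) := by
      intro R hR
      rw [Finset.mem_powerset] at hR
      rw [binomialRandom_pattern_inter p (A T) (A R) hAT]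
      · have hcard1 : (A T ∩ A R).card = R.card := by
          rw [← Finset.image_inter _ _ hinj, Finset.inter_eq_right.2 hR,
            Finset.card_image_of_injective _ hinj]
        have hcard2 : (A T \ A R).card = T.card - R.card := by
          rw [← Finset.image_sdiff _ _ hinj, Finset.card_image_of_injective _ hinj,
            Finset.card_sdiff_of_subset hR]
        have hdisj : Disjoint (s.1.erase u) R :=
          Finset.disjoint_of_subset_left (Finset.erase_subset _ _)
            (Finset.disjoint_of_subset_right (hR.trans (Finset.erase_subset _ _)) hs)
        -- The active set loses at most one vertex; it loses none at a restart, which only helps.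
        have hcard3 : (s.1.card : ℝ) + R.card ≤ (exploreWith s R).1.card + 1 := by
          have h1 : (exploreWith s R).1.card = (s.1.erase u).card + R.card :=
            Finset.card_union_of_disjoint hdisj
          have h2 := Finset.pred_card_le_card_erase (s := s.1) (a := u)
          norm_cast
          omega
        have hE := ih (exploreWith s R) (disjoint_exploreWith hs R)
        rw [hcard1, hcard2]
        calc _ ≤ (p : ℝ) ^ R.card * (1 - p) ^ (T.card - R.card) *
              (Real.exp (l * ((k + 1 : ℕ) - s.1.card) + R.card * (-l)) *
                ((p * Real.exp (-l) + (1 - p)) ^ m) ^ k) := by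
              refine mul_le_mul_of_nonneg_left (hE.trans ?_) (by positivity)
              refine mul_le_mul_of_nonneg_right (Real.exp_le_exp.2 ?_) (by positivity)
              push_cast
              nlinarith
          _ = _ := by
              rw [Real.exp_add, mul_pow, Real.exp_nat_mul]
              ring
      · intro G G' h
        have : (exploreStep G)^[k] (exploreWith s R) = (exploreStep G')^[k] (exploreWith s R) := by
          refine exploreStep_iterate_congr k fun v hv w hw => h s(v, w) fun hvw => ?_
          rw [union_exploreWith hR] at hv hw
          obtain ⟨t, ht, htt⟩ := Finset.mem_image.1 hvw
          rw [Sym2.eq_iff] at htt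
          rcases htt with ⟨h1, -⟩ | ⟨h1, -⟩
          · exact Finset.ne_of_mem_erase hv h1.symm
          · exact Finset.ne_of_mem_erase hw h1.symm
        simp only [E, Set.mem_ofPred_eq, this, imp_self]
    calc _ ≤ (binomialRandom V p).real (⋃ R ∈ T.powerset, Q R ∩ E R) :=
          measureReal_mono hsub (measure_ne_top _ _)
      _ ≤ ∑ R ∈ T.powerset, (binomialRandom V p).real (Q R ∩ E R) :=
          measureReal_biUnion_finset_le _ _
      _ ≤ _ := Finset.sum_le_sum hterm
      -- The binomial theorem sums the weights to the Laplace transform of a binomial variable with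
      -- `T.card` trials.
      _ = Real.exp (l * ((k + 1 : ℕ) - s.1.card)) * ((p * Real.exp (-l) + (1 - p)) ^ m) ^ k *
            (p * Real.exp (-l) + (1 - p)) ^ T.card := by
          rw [← Finset.mul_sum, Finset.sum_pow_mul_eq_add_pow]
      _ ≤ Real.exp (l * ((k + 1 : ℕ) - s.1.card)) * ((p * Real.exp (-l) + (1 - p)) ^ m) ^ k *
            (p * Real.exp (-l) + (1 - p)) ^ m :=
          mul_le_mul_of_nonneg_left (pow_le_pow_of_le_one hq0 hq1 hTm) (by positivity)
      _ = _ := by rw [pow_succ]; ring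

/-- The probability that the binomial random graph has no component with at least `b - a` vertices
is bounded by a sum of exponentials. -/
theorem binomialRandom_no_large_component_le [Fintype V] (p : I) {l : ℝ} (hl : 0 ≤ l) (a b : ℕ) :
    (binomialRandom V p).real {G | ¬ ∃ r, b - a ≤ {v | G.Reachable r v}.ncard} ≤
      ∑ k ∈ Finset.Ico a b, Real.exp (l * k) *
        ((p * Real.exp (-l) + (1 - p)) ^ (Fintype.card V - k)) ^ k := by
  have hsub : {G : SimpleGraph V | ¬ ∃ r, b - a ≤ {v | G.Reachable r v}.ncard} ⊆
      ⋃ k ∈ Finset.Ico a b, {G | ((exploreStep G)^[k] (∅, Finset.univ)).1 = ∅ ∧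
        Fintype.card V - k ≤ ((exploreStep G)^[k] (∅, Finset.univ)).2.card} := by
    intro G hG
    by_contra hc
    simp only [Set.mem_iUnion, not_exists] at hc
    refine hG (exists_le_ncard_reachable fun j hj hjb => Finset.nonempty_iff_ne_empty.2 fun h => ?_)
    refine hc j (Finset.mem_Ico.2 ⟨hj, hjb⟩) ⟨h, ?_⟩
    have := card_le_card_exploreStep_iterate G j (∅, Finset.univ)
    rw [h] at this
    simp only [Finset.empty_union, Finset.card_univ] at this
    omega
  refine (measureReal_mono hsub (measure_ne_top _ _)).trans
    ((measureReal_biUnion_finset_le _ _).trans (Finset.sum_le_sum fun k _ => ?_))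
  have h := binomialRandom_exploreStep_iterate_le (V := V) p hl
    (Fintype.card V - k) k (∅, Finset.univ) (by simp)
  simpa using h

end Exploration

end SimpleGraph

/-! ### Balanced separators from tree-decompositions. -/

namespace SimpleGraph

/-- In a tree, every vertex `z ≠ x` lies in a branch at `x`, named by the neighbour of `x` it
contains; adjacent vertices other than `x` lie in the same branch. -/
theorem IsTree.exists_branch {N : Type*} {T : SimpleGraph N} (hT : T.IsTree) (x : N) :
    ∃ b : N → N, (∀ z, z ≠ x → T.Adj x (b z) ∧ T.dist (b z) z + 1 ≤ T.dist x z) ∧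
      ∀ z z', z ≠ x → z' ≠ x → T.Adj z z' → b z = b z' := by
  choose p hp hlen using fun z => hT.connected.exists_path_of_dist x z
  have hnil : ∀ z, z ≠ x → ¬ (p z).Nil := fun z hz => Walk.not_nil_of_ne hz.symm
  have hconcat : ∀ z z', z ≠ x → T.Adj z z' → z ∈ (p z').support → (p z).snd = (p z').snd := by
    intro z z' hz hadj hmem
    rw [hT.isAcyclic.path_concat (hp z) (hp z') hadj hmem]
    have := hnil z hz
    cases h : p z with
    | nil => simp [h] at this
    | cons h q => simp [Walk.concat_cons]
  refine ⟨fun z => (p z).snd, fun z hz => ⟨(p z).adj_snd (hnil z hz), ?_⟩, fun z z' hz hz' h => ?_⟩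
  · rw [← hlen, ← Walk.length_tail_add_one (hnil z hz)]
    exact Nat.succ_le_succ (dist_le _)
  -- In a tree, one of the two paths from `x` extends the other by the edge between `z` and `z'`.
  · by_cases hmem : z ∈ (p z').support
    · exact hconcat z z' hz h hmem
    · exact (hconcat z' z hz' h.symm
        (hT.isAcyclic.mem_support_of_ne_mem_support_of_adj_of_isPath (hp z) (hp z') h hmem)).symm

theorem Preconnected.apply_eq {W α : Type*} {H : SimpleGraph W} (hH : H.Preconnected) {f : W → α}
    (hf : ∀ u v, H.Adj u v → f u = f v) (u v : W) : f u = f v := by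
  obtain ⟨p⟩ := hH u v
  induction p with
  | nil => rfl
  | cons h _ ih => exact (hf _ _ h).trans ih

end SimpleGraph

/-- A coloured finite set without a dominating colour splits evenly into two unions of colour
classes. -/
theorem Finset.exists_balanced_of_card_fiber_le {V ι : Type*} [DecidableEq V] [DecidableEq ι]
    (W : Finset V) (c : V → ι) {l : ℕ} (hc : ∀ i, 2 * (W.filter (c · = i)).card ≤ l)
    (hW : 3 * l ≤ 4 * W.card) :
    ∃ J : Finset ι, l ≤ 8 * (W.filter (c · ∈ J)).card ∧
      l ≤ 8 * (W \ W.filter (c · ∈ J)).card := by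
  -- Colours are added one at a time. On first reaching `l/8` the total is at most `l/8 + l/2 =
  -- 5l/8`, which leaves at least `3l/4 - 5l/8 = l/8`.
  suffices h : ∀ J : Finset ι, (∃ J' : Finset ι, l ≤ 8 * (W.filter (c · ∈ J')).card ∧
      8 * (W.filter (c · ∈ J')).card ≤ 5 * l) ∨ 8 * (W.filter (c · ∈ J)).card < l by
    rcases h (W.image c) with ⟨J, h1, h2⟩ | h
    · refine ⟨J, h1, ?_⟩
      have := Finset.card_sdiff_add_card_eq_card (Finset.filter_subset (c · ∈ J) W)
      omega
    · rw [Finset.filter_true_of_mem fun v hv => Finset.mem_image_of_mem c hv] at h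
      omega
  intro J
  induction J using Finset.induction_on with
  | empty =>
    rcases Nat.eq_zero_or_pos l with rfl | h
    · exact Or.inl ⟨∅, by simp⟩
    · exact Or.inr (by simpa using h)
  | insert i J _ ih =>
    rcases ih with h | h
    · exact Or.inl h
    · have hsub : W.filter (c · ∈ insert i J) ⊆ W.filter (c · ∈ J) ∪ W.filter (c · = i) := by
        intro v
        simp only [Finset.mem_filter, Finset.mem_union, Finset.mem_insert]
        tauto
      have h1 := (Finset.card_le_card hsub).trans (Finset.card_union_le _ _)
      have h2 := hc i
      by_cases h3 : 8 * (W.filter (c · ∈ insert i J)).card < l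
      · exact Or.inr h3
      · exact Or.inl ⟨insert i J, by omega, by omega⟩

/-- Every vertex set `L` is separated evenly by some bag of a tree-decomposition. -/
theorem TreeDecomposition.exists_balanced_separator {V : Type*} [DecidableEq V]
    {G : SimpleGraph V} (D : TreeDecomposition G) {k : ℕ} (hk : ∀ x, (D.bag x).card ≤ k)
    (L : Finset V) (hL : 4 * k ≤ L.card) :
    ∃ S A : Finset V, S.card ≤ k ∧ A ⊆ L \ S ∧ L.card ≤ 8 * A.card ∧
      L.card ≤ 8 * ((L \ S) \ A).card ∧ ∀ a ∈ A, ∀ b ∈ (L \ S) \ A, ¬ G.Adj a b := by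
  classical
  have := D.finite_node
  have hne := D.isTree.connected.nonempty
  have hz : ∀ v, ∃ z, v ∈ D.bag z := fun v => by
    obtain ⟨z⟩ := (D.connected_induce v).nonempty
    exact ⟨z.1, z.2⟩
  choose z hz using hz
  -- The separator is the bag at a median node. Moving from it to a neighbour gains one for each
  -- vertex in that branch and loses at most one for every other, so no branch holds more than half
  -- of `L`.
  obtain ⟨x, hx⟩ := Finite.exists_min fun x => ∑ v ∈ L, D.tree.dist x (z v)
  obtain ⟨b, hb, hb'⟩ := D.isTree.exists_branch x
  have hne_x : ∀ v w, v ∉ D.bag x → v ∈ D.bag w → w ≠ x := fun v w h h' hw => h (hw ▸ h')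
  -- The nodes whose bags contain `v` form a subtree avoiding `x`, hence lie in one branch.
  have hconst : ∀ v w, v ∉ D.bag x → v ∈ D.bag w → b w = b (z v) := by
    intro v w hv hw
    refine (D.connected_induce v).preconnected.apply_eq (f := fun w => b w.1) ?_ ⟨w, hw⟩ ⟨z v, hz v⟩
    exact fun w w' h => hb' _ _ (hne_x v _ hv w.2) (hne_x v _ hv w'.2) h
  have hfib : ∀ y, 2 * ((L \ D.bag x).filter (fun v => b (z v) = y)).card ≤ L.card := by
    intro y
    rcases ((L \ D.bag x).filter (fun v => b (z v) = y)).eq_empty_or_nonempty with h | ⟨v₀, hv₀⟩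
    · simp [h]
    have hxy : D.tree.Adj x y := by
      simp only [Finset.mem_filter, Finset.mem_sdiff] at hv₀
      rw [← hv₀.2]
      exact (hb _ (hne_x v₀ _ hv₀.1.2 (hz v₀))).1
    obtain ⟨P, hP⟩ : ∃ P : V → Prop, ∀ v, P v ↔ v ∉ D.bag x ∧ b (z v) = y :=
      ⟨_, fun _ => Iff.rfl⟩
    have hset : (L \ D.bag x).filter (fun v => b (z v) = y) = L.filter (fun v => P v) := by
      ext v
      simp [hP, and_assoc]
    have hterm : ∀ v ∈ L, D.tree.dist y (z v) + (if P v then 1 else 0) ≤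
        D.tree.dist x (z v) + (if ¬ P v then 1 else 0) := by
      intro v _
      by_cases hv : P v
      · simp only [hv, if_true, not_true, if_false]
        rw [← ((hP v).1 hv).2]
        exact (hb _ (hne_x v _ ((hP v).1 hv).1 (hz v))).2
      · simp only [hv, if_false, not_false_eq_true, if_true]
        have h1 := D.isTree.connected.dist_triangle (u := y) (v := x) (w := z v)
        have h2 : D.tree.dist y x = 1 := SimpleGraph.dist_eq_one_iff_adj.2 hxy.symm
        omega
    have hsum := Finset.sum_le_sum hterm
    rw [Finset.sum_add_distrib, Finset.sum_add_distrib, ← Finset.card_filter,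
      ← Finset.card_filter] at hsum
    have h3 := Finset.card_filter_add_card_filter_not (s := L) (fun v => P v)
    have h4 := hx y
    rw [hset]
    omega
  have hW : 3 * L.card ≤ 4 * (L \ D.bag x).card := by
    have h1 := Finset.le_card_sdiff (D.bag x) L
    have h2 := hk x
    omega
  obtain ⟨J, h1, h2⟩ := (L \ D.bag x).exists_balanced_of_card_fiber_le (fun v => b (z v)) hfib hW
  refine ⟨D.bag x, _, hk x, Finset.filter_subset _ _, h1, h2, fun u hu v hv huv => ?_⟩
  obtain ⟨w, hwu, hwv⟩ := D.exists_bag u v huv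
  simp only [Finset.mem_filter, Finset.mem_sdiff] at hu hv
  rw [← hconst u w hu.1.2 hwu, hconst v w hv.1.2 hwv] at hu
  exact hv.2 ⟨hv.1, hu.2⟩

/-- Some tree-decomposition of `G` has all bags of size at most `treeWidth G + 1`. -/
theorem exists_treeDecomposition_card_bag_le {V : Type*} [Finite V] (G : SimpleGraph V) :
    ∃ D : TreeDecomposition G, ∀ x, ((D.bag x).card : ℤ) ≤ treeWidth G + 1 := by
  obtain ⟨D, hD⟩ := (treeWidth_isLeast G).1
  refine ⟨D, fun x => ?_⟩
  have := D.finite_node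
  have h := le_ciSup (Set.finite_range
    (fun x : D.Node => (((D.bag x).card : ℤ) - 1))).bddAbove x
  rw [← hD]
  change _ ≤ (⨆ x : D.Node, (((D.bag x).card : ℤ) - 1)) + 1
  linarith

/-! ### Counting separations and sprinkling. -/

namespace SimpleGraph

open MeasureTheory ProbabilityTheory unitInterval

section Separation

variable {V : Type*} [Fintype V]

/-- Markov's inequality for the number of sets with at most `k` elements. -/
theorem card_filter_card_le {k : ℕ} {x : ℝ} (hx0 : 0 < x) (hx1 : x ≤ 1) :
    ((Finset.univ.filter fun S : Finset V => S.card ≤ k).card : ℝ) ≤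
      x⁻¹ ^ k * Real.exp (x * Fintype.card V) := by
  have h1 : ((Finset.univ.filter fun S : Finset V => S.card ≤ k).card : ℝ) * x ^ k ≤
      ∑ S : Finset V, x ^ S.card := by
    rw [← nsmul_eq_mul, ← Finset.sum_const]
    refine (Finset.sum_le_sum fun S hS => ?_).trans (Finset.sum_le_sum_of_subset_of_nonneg
      (Finset.filter_subset _ _) fun S _ _ => by positivity)
    exact pow_le_pow_of_le_one hx0.le hx1 (Finset.mem_filter.1 hS).2
  have h2 : ∑ S : Finset V, x ^ S.card = (x + 1) ^ Fintype.card V := by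
    have := Finset.sum_pow_mul_eq_add_pow x 1 (Finset.univ : Finset V)
    simpa using this
  have h3 : (x + 1) ^ Fintype.card V ≤ Real.exp (x * Fintype.card V) := by
    rw [mul_comm, Real.exp_nat_mul]
    exact pow_le_pow_left₀ (by positivity) (Real.add_one_le_exp x) _
  rw [inv_pow, inv_mul_eq_div, le_div_iff₀ (by positivity)]
  linarith

variable [DecidableEq V]

open scoped Classical in
/-- The vertices outside `S` with a neighbour in `S`. -/
noncomputable def outerBoundary (H : SimpleGraph V) (S : Finset V) : Finset V :=
  Sᶜ.filter fun v => ∃ s ∈ S, H.Adj s v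

theorem mem_outerBoundary {H : SimpleGraph V} {S : Finset V} {v : V} :
    v ∈ H.outerBoundary S ↔ v ∉ S ∧ ∃ s ∈ S, H.Adj s v := by
  simp [outerBoundary]

open scoped Classical in
/-- The nontrivial unions of components of `H[L \ S]`. -/
noncomputable def separatedParts (H : SimpleGraph V) (L S : Finset V) : Finset (Finset V) :=
  (L \ S).powerset.filter fun A => A.Nonempty ∧ ((L \ S) \ A).Nonempty ∧
    ∀ a ∈ A, ∀ b ∈ (L \ S) \ A, ¬ H.Adj a b

theorem mem_separatedParts {H : SimpleGraph V} {L S A : Finset V} :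
    A ∈ H.separatedParts L S ↔ A ⊆ L \ S ∧ A.Nonempty ∧ ((L \ S) \ A).Nonempty ∧
      ∀ a ∈ A, ∀ b ∈ (L \ S) \ A, ¬ H.Adj a b := by
  simp [separatedParts]

/-- `A` is recovered from its trace on the outer boundary of `S`. As `L` is connected and `A` omits
a vertex of `L \ S`, every vertex of `A` has a walk to `S`. Up to its first arrival in `S` this walk
stays in `A`, and the vertex just before lies in the boundary; another part containing that vertex
contains the whole stretch. -/
theorem card_separatedParts_le {H : SimpleGraph V} {L : Finset V} {r : V}
    (hL : ∀ v, v ∈ L ↔ H.Reachable r v) (S : Finset V) :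
    (H.separatedParts L S).card ≤ 2 ^ (H.outerBoundary S).card := by
  have hstep : ∀ {u v}, u ∈ L → H.Adj u v → v ∈ L := fun hu h =>
    (hL _).2 (((hL _).1 hu).trans h.reachable)
  have hmeet : ∀ A ∈ H.separatedParts L S, ∀ v ∈ A, ∃ s ∈ S, H.Reachable v s := by
    intro A hA v hv
    obtain ⟨hsub, -, ⟨b, hb⟩, hsep⟩ := mem_separatedParts.1 hA
    obtain ⟨p⟩ := ((hL v).1 (Finset.mem_sdiff.1 (hsub hv)).1).symm.trans
      ((hL b).1 (Finset.mem_sdiff.1 (Finset.mem_sdiff.1 hb).1).1)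
    induction p with
    | nil => exact absurd hv (Finset.mem_sdiff.1 hb).2
    | @cons v w b hvw _ ih =>
      by_cases hw : w ∈ S
      · exact ⟨w, hw, hvw.reachable⟩
      · have hwL : w ∈ L \ S :=
          Finset.mem_sdiff.2 ⟨hstep (Finset.mem_sdiff.1 (hsub hv)).1 hvw, hw⟩
        have hwA : w ∈ A := by
          by_contra h
          exact hsep v hv w (Finset.mem_sdiff.2 ⟨hwL, h⟩) hvw
        obtain ⟨s, hs, hws⟩ := ih hwA hb
        exact ⟨s, hs, hvw.reachable.trans hws⟩
  have hsubset : ∀ A ∈ H.separatedParts L S, ∀ A' ∈ H.separatedParts L S,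
      A ∩ H.outerBoundary S ⊆ A' → A ⊆ A' := by
    intro A hA A' hA' hAA' v hv
    obtain ⟨s, hs, ⟨p⟩⟩ := hmeet A hA v hv
    obtain ⟨hsub, -, -, hsep⟩ := mem_separatedParts.1 hA
    obtain ⟨-, -, -, hsep'⟩ := mem_separatedParts.1 hA'
    induction p with
    | nil => exact absurd hs (Finset.mem_sdiff.1 (hsub hv)).2
    | @cons v w s hvw _ ih =>
      have hvL := Finset.mem_sdiff.1 (hsub hv)
      by_cases hw : w ∈ S
      · exact hAA' (Finset.mem_inter.2 ⟨hv, mem_outerBoundary.2 ⟨hvL.2, w, hw, hvw.symm⟩⟩)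
      · have hwL : w ∈ L \ S := Finset.mem_sdiff.2 ⟨hstep hvL.1 hvw, hw⟩
        have hwA : w ∈ A := by
          by_contra h
          exact hsep v hv w (Finset.mem_sdiff.2 ⟨hwL, h⟩) hvw
        by_contra h
        exact hsep' w (ih hwA hs) v (Finset.mem_sdiff.2 ⟨hsub hv, h⟩) hvw.symm
  rw [← Finset.card_powerset]
  refine Finset.card_le_card_of_injOn (fun A => A ∩ H.outerBoundary S)
    (fun A _ => Finset.mem_powerset.2 Finset.inter_subset_right) fun A hA A' hA' h => ?_
  simp only at h
  exact subset_antisymm (hsubset A hA A' hA' (h ▸ Finset.inter_subset_left))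
    (hsubset A' hA' A hA (h ▸ Finset.inter_subset_left))

/-- Each boundary vertex owns an edge to `S`, so the integrand is at most the number of sets of
present edges leaving `S`. A given set `F` of such pairs is present with probability `p ^ F.card`,
and the binomial theorem sums these. -/
theorem integral_two_pow_card_outerBoundary_le (p : I) (S : Finset V) :
    ∫ H, (2 : ℝ) ^ (outerBoundary H S).card ∂(binomialRandom V p) ≤
      (1 + (p : ℝ)) ^ (S.card * Fintype.card V) := by
  classical
  set Q : Finset (Sym2 V) := (S ×ˢ Sᶜ).image fun x => s(x.1, x.2) with hQ
  have hQdiag : ∀ e ∈ Q, ¬ e.IsDiag := by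
    intro e he
    obtain ⟨⟨s, v⟩, hx, rfl⟩ := Finset.mem_image.1 he
    simp only [Finset.mem_product, Finset.mem_compl] at hx
    rw [Sym2.mk_isDiag_iff]
    exact fun h => hx.2 ((show s = v from h) ▸ hx.1)
  have hQcard : Q.card ≤ S.card * Fintype.card V :=
    Finset.card_image_le.trans (by
      rw [Finset.card_product]
      exact Nat.mul_le_mul_left _ (Finset.card_le_univ _))
  have hle : ∀ H : SimpleGraph V, (2 : ℝ) ^ (outerBoundary H S).card ≤
      ∑ F ∈ Q.powerset, Set.indicator {H : SimpleGraph V | ∀ e ∈ F, e ∈ H.edgeSet}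
        (fun _ => (1 : ℝ)) H := by
    intro H
    have h1 : (outerBoundary H S).card ≤ (Q.filter (· ∈ H.edgeSet)).card := by
      have hs : ∀ v ∈ outerBoundary H S, ∃ s ∈ S, H.Adj s v := fun v hv =>
        (mem_outerBoundary.1 hv).2
      choose! f hf hadj using hs
      refine Finset.card_le_card_of_injOn (fun v => s(f v, v)) (fun v hv => ?_) ?_
      · have hv' := (mem_outerBoundary.1 hv).1
        refine Finset.mem_filter.2 ⟨Finset.mem_image.2 ⟨(f v, v), ?_, rfl⟩, hadj v hv⟩
        exact Finset.mem_product.2 ⟨hf v hv, Finset.mem_compl.2 hv'⟩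
      · intro v hv w hw h
        rcases Sym2.eq_iff.1 h with ⟨-, h⟩ | ⟨h, -⟩
        · exact h
        · exact absurd (h ▸ hf v hv) (mem_outerBoundary.1 hw).1
    have h2 : ∑ F ∈ Q.powerset, Set.indicator {H : SimpleGraph V | ∀ e ∈ F, e ∈ H.edgeSet}
        (fun _ => (1 : ℝ)) H = 2 ^ (Q.filter (· ∈ H.edgeSet)).card := by
      simp only [Set.indicator_apply, Set.mem_ofPred_eq]
      rw [← Finset.sum_filter, Finset.sum_const, nsmul_one]
      have : Q.powerset.filter (fun F => ∀ e ∈ F, e ∈ H.edgeSet) =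
          (Q.filter (· ∈ H.edgeSet)).powerset := by
        ext F
        simp only [Finset.mem_filter, Finset.mem_powerset, Finset.subset_iff]
        exact ⟨fun h e he => ⟨h.1 he, h.2 e he⟩, fun h => ⟨fun e he => (h he).1, fun e he => (h he).2⟩⟩
      rw [this, Finset.card_powerset]
      norm_cast
    rw [h2]
    exact pow_le_pow_right₀ (by norm_num) h1
  calc _ ≤ ∫ H, ∑ F ∈ Q.powerset, Set.indicator {H : SimpleGraph V | ∀ e ∈ F, e ∈ H.edgeSet}
        (fun _ => (1 : ℝ)) H ∂(binomialRandom V p) :=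
        integral_mono .of_finite .of_finite hle
    _ = ∑ F ∈ Q.powerset, (p : ℝ) ^ F.card * 1 ^ (Q.card - F.card) := by
        rw [integral_finsetSum _ fun _ _ => .of_finite]
        refine Finset.sum_congr rfl fun F hF => ?_
        rw [integral_indicator_const _ .of_discrete, binomialRandom_forall_mem_edgeSet p F
          fun e he => hQdiag e (Finset.mem_powerset.1 hF he)]
        simp
    _ = (1 + (p : ℝ)) ^ Q.card := by rw [Finset.sum_pow_mul_eq_add_pow, add_comm]
    _ ≤ _ := pow_le_pow_right₀ (by linarith [p.2.1]) hQcard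

theorem binomialRandom_no_edge_between (p : I) {A B : Finset V} (hAB : Disjoint A B) :
    (binomialRandom V p).real {G | ∀ a ∈ A, ∀ b ∈ B, ¬ G.Adj a b} ≤
      Real.exp (-(p * (A.card * B.card))) := by
  have hdisj : ∀ a ∈ A, ∀ b ∈ B, a ≠ b := fun a ha b hb h =>
    Finset.disjoint_left.1 hAB ha (h ▸ hb)
  have hinj : Set.InjOn (fun x : V × V => s(x.1, x.2)) (A ×ˢ B : Finset (V × V)) := by
    rintro ⟨a, b⟩ h ⟨a', b'⟩ h' heq
    simp only [Finset.coe_product, Set.mem_prod, Finset.mem_coe] at h h'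
    rcases Sym2.eq_iff.1 heq with ⟨h1, h2⟩ | ⟨h1, h2⟩
    · exact Prod.ext h1 h2
    · exact absurd h1 (hdisj a h.1 b' h'.2)
  have h := binomialRandom_forall_notMem_edgeSet (V := V) p
    ((A ×ˢ B).image fun x => s(x.1, x.2)) (by
      intro e he
      obtain ⟨⟨a, b⟩, hx, rfl⟩ := Finset.mem_image.1 he
      rw [Finset.mem_product] at hx
      rw [Sym2.mk_isDiag_iff]
      exact hdisj a hx.1 b hx.2)
  rw [Finset.card_image_of_injOn hinj, Finset.card_product] at h
  have hset : {G : SimpleGraph V | ∀ a ∈ A, ∀ b ∈ B, ¬ G.Adj a b} =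
      {G | ∀ e ∈ (A ×ˢ B).image fun x => s(x.1, x.2), e ∉ G.edgeSet} := by
    ext G
    simp only [Set.mem_ofPred_eq, Finset.forall_mem_image, Finset.mem_product, Prod.forall,
      mem_edgeSet, and_imp]
    exact ⟨fun h a b ha hb => h a ha b hb, fun h a ha b hb => h a b ha hb⟩
  rw [hset, h]
  calc (1 - (p : ℝ)) ^ (A.card * B.card) ≤ Real.exp (-p) ^ (A.card * B.card) := by
        refine pow_le_pow_left₀ (sub_nonneg.2 p.2.2) ?_ _
        linarith [Real.add_one_le_exp (-(p : ℝ))]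
    _ = _ := by
        rw [← Real.exp_nat_mul]
        push_cast
        ring_nf

/-- `L` has a balanced separation of order at most `k` in `G`. -/
def HasBalancedSeparation (G : SimpleGraph V) (k : ℕ) (L : Finset V) : Prop :=
  ∃ S A : Finset V, S.card ≤ k ∧ A ⊆ L \ S ∧ L.card ≤ 8 * A.card ∧
    L.card ≤ 8 * ((L \ S) \ A).card ∧ ∀ a ∈ A, ∀ b ∈ (L \ S) \ A, ¬ G.Adj a b

open scoped Classical in
/-- The probability that sprinkling leaves a component `L` of `H` with a balanced separation. -/
theorem binomialRandom_hasBalancedSeparation_sup_le (p : I) {H : SimpleGraph V} {L : Finset V}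
    {r : V} (hL : ∀ v, v ∈ L ↔ H.Reachable r v) (k : ℕ) {l : ℕ} (hl : l ≤ L.card) :
    (binomialRandom V p).real {G | HasBalancedSeparation (H ⊔ G) k L} ≤
      ∑ S : Finset V with S.card ≤ k, 2 ^ (outerBoundary H S).card *
        Real.exp (-(p * (l ^ 2 / 64))) := by
  have hLpos : 0 < L.card := Finset.card_pos.2 ⟨r, (hL r).2 (Reachable.refl r)⟩
  let Z : Finset V → Finset (Finset V) := fun S => (H.separatedParts L S).filter fun A =>
    L.card ≤ 8 * A.card ∧ L.card ≤ 8 * ((L \ S) \ A).card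
  have hsub : {G | HasBalancedSeparation (H ⊔ G) k L} ⊆
      ⋃ S ∈ Finset.univ.filter fun S : Finset V => S.card ≤ k, ⋃ A ∈ Z S,
        {G : SimpleGraph V | ∀ a ∈ A, ∀ b ∈ (L \ S) \ A, ¬ G.Adj a b} := by
    rintro G ⟨S, A, hS, hA, h1, h2, h3⟩
    simp only [Set.mem_iUnion]
    refine ⟨S, by simpa using hS, A, Finset.mem_filter.2 ⟨mem_separatedParts.2 ⟨hA,
      Finset.card_pos.1 (by omega), Finset.card_pos.1 (by omega), fun a ha b hb h => ?_⟩, h1, h2⟩,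
      fun a ha b hb h => ?_⟩
    · exact h3 a ha b hb (Or.inl h)
    · exact h3 a ha b hb (Or.inr h)
  refine (measureReal_mono hsub (measure_ne_top _ _)).trans
    ((measureReal_biUnion_finset_le _ _).trans (Finset.sum_le_sum fun S _ => ?_))
  refine (measureReal_biUnion_finset_le _ _).trans ?_
  calc _ ≤ ∑ A ∈ Z S, Real.exp (-(p * (l ^ 2 / 64))) := by
        refine Finset.sum_le_sum fun A hA => ?_
        refine (binomialRandom_no_edge_between p Finset.disjoint_sdiff).trans
          (Real.exp_le_exp.2 (neg_le_neg (mul_le_mul_of_nonneg_left ?_ p.2.1)))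
        obtain ⟨-, h1, h2⟩ := Finset.mem_filter.1 hA
        have h1' : (l : ℝ) ≤ 8 * A.card := by exact_mod_cast hl.trans h1
        have h2' : (l : ℝ) ≤ 8 * ((L \ S) \ A).card := by exact_mod_cast hl.trans h2
        nlinarith [mul_le_mul h1' h2' (by positivity) (by positivity)]
    _ = (Z S).card * Real.exp (-(p * (l ^ 2 / 64))) := by rw [Finset.sum_const, nsmul_eq_mul]
    _ ≤ _ := by
        refine mul_le_mul_of_nonneg_right ?_ (Real.exp_pos _).le
        exact_mod_cast (Finset.card_filter_le _ _).trans (card_separatedParts_le hL S)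

/-- If `G(V, p)` is the union of independent `G(V, p₁)` and `G(V, p₂)`, where `G(V, p₁)` has a
component with `l` vertices, then it is unlikely that all sets of `l` vertices have balanced
separations of small order. -/
theorem binomialRandom_forall_hasBalancedSeparation_le {p p₁ p₂ : I}
    (hp : 1 - (p : ℝ) = (1 - p₁) * (1 - p₂)) (k l : ℕ) :
    (binomialRandom V p).real {G | ∀ L : Finset V, l ≤ L.card → HasBalancedSeparation G k L} ≤
      (binomialRandom V p₁).real {G | ¬ ∃ r, l ≤ {v | G.Reachable r v}.ncard} +
        ∑ S : Finset V with S.card ≤ k, (1 + (p₁ : ℝ)) ^ (S.card * Fintype.card V) *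
          Real.exp (-(p₂ * (l ^ 2 / 64))) := by
  classical
  set B : Set (SimpleGraph V) := {G | ¬ ∃ r, l ≤ {v | G.Reachable r v}.ncard} with hB
  set E : Set (SimpleGraph V) :=
    {G | ∀ L : Finset V, l ≤ L.card → HasBalancedSeparation G k L} with hE
  let f : SimpleGraph V → ℝ := fun H =>
    ∑ S : Finset V with S.card ≤ k, 2 ^ (outerBoundary H S).card *
        Real.exp (-(p₂ * (l ^ 2 / 64)))
  have hf0 : ∀ H, 0 ≤ f H := fun H => Finset.sum_nonneg fun S _ => by positivity
  -- For fixed `H` outside `B`, the event is used only at the large component of `H`; quantifying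
  -- over all `L` avoids having to identify that component in the union.
  have hsec : ∀ H, (binomialRandom V p₂).real {G | H ⊔ G ∈ E} ≤ B.indicator (fun _ => 1) H + f H := by
    intro H
    by_cases hH : H ∈ B
    · rw [Set.indicator_of_mem hH]
      exact measureReal_le_one.trans (le_add_of_nonneg_right (hf0 H))
    · rw [Set.indicator_of_notMem hH, zero_add]
      simp only [hB, Set.mem_ofPred_eq, not_not] at hH
      obtain ⟨r, hr⟩ := hH
      have hL : ∀ v, v ∈ {v | H.Reachable r v}.toFinset ↔ H.Reachable r v := by simp
      have hl : l ≤ {v | H.Reachable r v}.toFinset.card := by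
        rwa [← Set.ncard_eq_toFinset_card']
      refine le_trans (measureReal_mono (fun G hG => ?_) (measure_ne_top _ _))
        (binomialRandom_hasBalancedSeparation_sup_le p₂ hL k hl)
      exact hG _ hl
  have hmeas : Measurable (fun x : SimpleGraph V × SimpleGraph V => x.1 ⊔ x.2) := .of_discrete
  have hint : (binomialRandom V p).real E =
      ∫ H, (binomialRandom V p₂).real {G | H ⊔ G ∈ E} ∂(binomialRandom V p₁) := by
    rw [measureReal_def, ← map_sup_binomialRandom hp, Measure.map_apply hmeas .of_discrete,
      Measure.prod_apply (hmeas .of_discrete), ← integral_toReal]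
    · rfl
    · exact Measurable.aemeasurable .of_discrete
    · exact .of_forall fun _ => measure_lt_top _ _
  rw [hint]
  calc _ ≤ ∫ H, (B.indicator (fun _ => 1) H + f H) ∂(binomialRandom V p₁) :=
        integral_mono .of_finite .of_finite hsec
    _ = (binomialRandom V p₁).real B + ∑ S : Finset V with S.card ≤ k,
        (∫ H, (2 : ℝ) ^ (outerBoundary H S).card ∂(binomialRandom V p₁)) *
          Real.exp (-(p₂ * (l ^ 2 / 64))) := by
        rw [integral_add .of_finite .of_finite, integral_indicator_const _ .of_discrete,
          integral_finsetSum _ fun _ _ => .of_finite]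
        simp [integral_mul_const]
    _ ≤ _ := by
        refine add_le_add_right (Finset.sum_le_sum fun S _ => ?_) _
        exact mul_le_mul_of_nonneg_right (integral_two_pow_card_outerBoundary_le p₁ S)
          (Real.exp_pos _).le

end Separation

end SimpleGraph

/-! ### Numerical estimates near the critical probability. -/

namespace SimpleGraph

open MeasureTheory ProbabilityTheory unitInterval

/-- Probabilities slightly above `1 / n` give a component of linear size. -/
theorem binomialRandom_no_linear_component_le {ε : ℝ} (h0 : 0 < ε) (h1 : ε ≤ 1 / 10) {n : ℕ}
    (hn : 0 < n) {p : I} (hp : (p : ℝ) = (1 + ε / 2) / n) :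
    (binomialRandom (Fin n) p).real
        {G | ¬ ∃ r, ⌊ε * n / 4⌋₊ - ⌈ε * n / 8⌉₊ ≤ {v | G.Reachable r v}.ncard} ≤
      n * Real.exp (-(ε ^ 3 / 4096 * n)) := by
  have : Nonempty (Fin n) := ⟨⟨0, hn⟩⟩
  have hn' : (0 : ℝ) < n := by exact_mod_cast hn
  set a := ⌈ε * n / 8⌉₊
  set b := ⌊ε * n / 4⌋₊
  have hbn : b ≤ n := by
    refine Nat.floor_le_of_le ?_
    nlinarith
  have hterm : ∀ k ∈ Finset.Ico a b, Real.exp (ε / 32 * k) *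
      ((p * Real.exp (-(ε / 32)) + (1 - p)) ^ (n - k)) ^ k ≤
        Real.exp (-(ε ^ 3 / 4096 * n)) := by
    intro k hk
    obtain ⟨hak, hkb⟩ := Finset.mem_Ico.1 hk
    have hk1 : ε * n / 8 ≤ k := Nat.ceil_le.1 hak
    have hk2 : (k : ℝ) ≤ ε * n / 4 := (Nat.le_floor_iff (by positivity)).1 hkb.le
    -- From `exp(-x) ≤ 1/(1 + x) ≤ 1 - x + x²`.
    have hexp : Real.exp (-(ε / 32)) ≤ 1 - ε / 32 + (ε / 32) ^ 2 := by
      rw [Real.exp_neg]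
      refine (inv_anti₀ (by positivity) (Real.add_one_le_exp (ε / 32))).trans ?_
      rw [inv_le_iff_one_le_mul₀ (by positivity)]
      nlinarith [pow_pos h0 3]
    have hbase : p * Real.exp (-(ε / 32)) + (1 - p) ≤
        Real.exp (-(p * (ε / 32 - (ε / 32) ^ 2))) := by
      refine le_trans ?_ (Real.add_one_le_exp _)
      nlinarith [mul_le_mul_of_nonneg_left hexp p.2.1]
    have hpow : ((p * Real.exp (-(ε / 32)) + (1 - p)) ^ (n - k)) ^ k ≤
        Real.exp (-(p * (ε / 32 - (ε / 32) ^ 2))) ^ ((n - k) * k) := by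
      rw [← pow_mul]
      refine pow_le_pow_left₀ ?_ hbase _
      have := p.2.1
      have := sub_nonneg.2 p.2.2
      positivity
    -- Up to time `εn/4` the exploration is still supercritical: `(1 + ε/2)(1 - ε/4) ≥ 1 + ε/8`.
    have hpnk : 1 + ε / 8 ≤ p * (n - k) := by
      rw [hp, div_mul_eq_mul_div, le_div_iff₀ hn']
      nlinarith [mul_nonneg h0.le hn'.le, mul_nonneg (mul_nonneg h0.le h0.le) hn'.le]
    calc _ ≤ Real.exp (ε / 32 * k) *
          Real.exp (-(p * (ε / 32 - (ε / 32) ^ 2))) ^ ((n - k) * k) :=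
          mul_le_mul_of_nonneg_left hpow (Real.exp_pos _).le
      _ = Real.exp (k * (ε / 32 - p * (n - k) * (ε / 32 - (ε / 32) ^ 2))) := by
          rw [← Real.exp_nat_mul, ← Real.exp_add]
          push_cast [Nat.cast_sub (hkb.le.trans hbn)]
          ring_nf
      _ ≤ _ := by
          refine Real.exp_le_exp.2 ?_
          have h2 : ε / 32 - p * (n - k) * (ε / 32 - (ε / 32) ^ 2) ≤ -(ε ^ 2 / 512) := by
            have h3 : 0 ≤ ε / 32 - (ε / 32) ^ 2 := by nlinarith
            nlinarith [mul_le_mul_of_nonneg_right hpnk h3, pow_pos h0 3, pow_pos h0 2]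
          have h4 := mul_le_mul_of_nonneg_left h2 (Nat.cast_nonneg (α := ℝ) k)
          nlinarith [mul_le_mul_of_nonneg_right hk1 (by positivity : 0 ≤ ε ^ 2 / 512)]
  have h := binomialRandom_no_large_component_le (V := Fin n) p (l := ε / 32) (by positivity) a b
  rw [Fintype.card_fin] at h
  refine h.trans ((Finset.sum_le_sum hterm).trans ?_)
  rw [Finset.sum_const, nsmul_eq_mul, Nat.card_Ico]
  exact mul_le_mul_of_nonneg_right (by exact_mod_cast (Nat.sub_le _ _).trans hbn)
    (Real.exp_pos _).le

/-- The expected number of balanced separations that survive sprinkling is small. -/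
theorem sum_pow_mul_exp_le {ε : ℝ} (h0 : 0 < ε) (h1 : ε ≤ 1 / 10 ^ 6) {n k : ℕ} (hn : 0 < n)
    {p₁ p₂ l : ℝ} (hp₁ : p₁ = (1 + ε / 2) / n) (hp₂ : ε / (2 * n) ≤ p₂) (hl : ε * n / 9 ≤ l)
    (hk : (k : ℝ) ≤ 1 / 10 ^ 6 * (ε ^ 3 / Real.log (1 / ε)) * n + 1) :
    ∑ S : Finset (Fin n) with S.card ≤ k, (1 + p₁) ^ (S.card * Fintype.card (Fin n)) *
        Real.exp (-(p₂ * (l ^ 2 / 64))) ≤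
      Real.exp (6 * Real.log (1 / ε)) * Real.exp (-(ε ^ 3 / 20000 * n)) := by
  have hn' : (0 : ℝ) < n := by exact_mod_cast hn
  set Λ := Real.log (1 / ε) with hΛ
  have hΛ1 : 1 ≤ Λ := by
    rw [hΛ, Real.le_log_iff_exp_le (by positivity), le_div_iff₀ h0]
    nlinarith [Real.exp_one_lt_d9, Real.exp_pos 1]
  have hp₁0 : 0 ≤ p₁ := by rw [hp₁]; positivity
  have hp₂0 : 0 ≤ p₂ := le_trans (by positivity) hp₂
  have hp₁n : p₁ * n ≤ 2 := by
    rw [hp₁, div_mul_cancel₀ _ hn'.ne']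
    linarith
  have hterm : ∀ S ∈ Finset.univ.filter (fun S : Finset (Fin n) => S.card ≤ k),
      (1 + p₁) ^ (S.card * Fintype.card (Fin n)) * Real.exp (-(p₂ * (l ^ 2 / 64))) ≤
        Real.exp (2 * k) * Real.exp (-(ε ^ 3 / 10368 * n)) := by
    intro S hS
    have hSk : (S.card : ℝ) ≤ k := by exact_mod_cast (Finset.mem_filter.1 hS).2
    refine mul_le_mul ?_ (Real.exp_le_exp.2 (neg_le_neg ?_)) (Real.exp_pos _).le (Real.exp_pos _).le
    · calc (1 + p₁) ^ (S.card * Fintype.card (Fin n)) ≤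
            Real.exp p₁ ^ (S.card * Fintype.card (Fin n)) :=
            pow_le_pow_left₀ (by positivity) (by linarith [Real.add_one_le_exp p₁]) _
        _ = Real.exp (S.card * (p₁ * n)) := by
            rw [← Real.exp_nat_mul, Fintype.card_fin]
            push_cast
            ring_nf
        _ ≤ _ := by
            refine Real.exp_le_exp.2 ?_
            calc (S.card : ℝ) * (p₁ * n) ≤ k * 2 :=
                  mul_le_mul hSk hp₁n (by positivity) (by positivity)
              _ = _ := by ring
    · calc ε ^ 3 / 10368 * n = ε / (2 * n) * ((ε * n / 9) ^ 2 / 64) := by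
            field_simp
            norm_num
        _ ≤ p₂ * (l ^ 2 / 64) := by gcongr
  -- With `x = ε⁴` the factor `x⁻¹ ^ k` is `exp(4kΛ)`, and `ε⁴n` is negligible against `ε³n` as `ε ≤
  -- 10⁻⁶`.
  have hcount : ((Finset.univ.filter fun S : Finset (Fin n) => S.card ≤ k).card : ℝ) ≤
      Real.exp (4 * k * Λ) * Real.exp (ε ^ 4 * n) := by
    have h := card_filter_card_le (V := Fin n) (k := k) (x := ε ^ 4) (by positivity)
      (pow_le_one₀ h0.le (by linarith))
    rw [Fintype.card_fin] at h
    refine h.trans_eq ?_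
    congr 1
    rw [mul_right_comm, mul_comm, Real.exp_nat_mul, show (4 : ℝ) * Λ = (4 : ℕ) * Λ by norm_num,
      Real.exp_nat_mul, hΛ, Real.exp_log (by positivity), one_div]
    simp only [inv_pow]
  have hkΛ : k * Λ ≤ 1 / 10 ^ 6 * ε ^ 3 * n + Λ := by
    calc k * Λ ≤ (1 / 10 ^ 6 * (ε ^ 3 / Λ) * n + 1) * Λ :=
          mul_le_mul_of_nonneg_right hk (by linarith)
      _ = _ := by
        field_simp
  calc _ ≤ _ := Finset.sum_le_sum hterm
    _ ≤ (Real.exp (4 * k * Λ) * Real.exp (ε ^ 4 * n)) *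
          (Real.exp (2 * k) * Real.exp (-(ε ^ 3 / 10368 * n))) := by
        rw [Finset.sum_const, nsmul_eq_mul]
        exact mul_le_mul_of_nonneg_right hcount (by positivity)
    _ ≤ _ := by
        rw [← Real.exp_add, ← Real.exp_add, ← Real.exp_add, ← Real.exp_add]
        refine Real.exp_le_exp.2 ?_
        have h2 : (k : ℝ) ≤ k * Λ := le_mul_of_one_le_right (by positivity) hΛ1
        have h3 : ε ^ 4 * n ≤ 1 / 10 ^ 6 * (ε ^ 3 * n) := by
          have : 0 ≤ ε ^ 3 * n := by positivity
          nlinarith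
        have h4 : 0 ≤ ε ^ 3 * n := by positivity
        nlinarith

/-- A bound for the probability that the tree-width of the supercritical random graph is small. -/
theorem binomialRandom_treeWidth_lt_le {ε : ℝ} (h0 : 0 < ε) (h1 : ε ≤ 1 / 10 ^ 6) {n : ℕ}
    (hn : 1000 ≤ ε * n) {p : I} (hp : (p : ℝ) = (1 + ε) / n) :
    (binomialRandom (Fin n) p).real {G | 1 / 10 ^ 6 * (ε ^ 3 / Real.log (1 / ε)) * (n : ℝ) ≤
        (treeWidth G : ℝ)}ᶜ ≤
      n * Real.exp (-(ε ^ 3 / 4096 * n)) +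
        Real.exp (6 * Real.log (1 / ε)) * Real.exp (-(ε ^ 3 / 20000 * n)) := by
  have hn1 : (1000 : ℝ) ≤ n := by nlinarith [Nat.cast_nonneg (α := ℝ) n]
  have hn' : (0 : ℝ) < n := by linarith
  have hn0 : 0 < n := by exact_mod_cast hn'
  set K := 1 / 10 ^ 6 * (ε ^ 3 / Real.log (1 / ε)) * (n : ℝ) with hK
  have hp₁ : (1 + ε / 2) / n ∈ Set.Icc (0 : ℝ) 1 :=
    ⟨by positivity, by rw [div_le_one hn']; linarith⟩
  have hp₁' : (1 + ε / 2) / n < 1 := by rw [div_lt_one hn']; linarith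
  have hp₁p : (1 + ε) / n - (1 + ε / 2) / n = ε / (2 * n) := by
    field_simp
    ring
  have hden : 0 < 1 - (1 + ε / 2) / (n : ℝ) := by linarith
  have hp1 := p.2.2
  rw [hp] at hp1
  -- This `p₂` solves `1 - p = (1 - p₁)(1 - p₂)`.
  have hp₂ : ε / (2 * n) / (1 - (1 + ε / 2) / n) ∈ Set.Icc (0 : ℝ) 1 :=
    ⟨by positivity, by rw [div_le_one hden]; linarith⟩
  have hsplit : 1 - (p : ℝ) = (1 - (1 + ε / 2) / n) * (1 - ε / (2 * n) / (1 - (1 + ε / 2) / n)) := by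
    rw [hp, mul_sub, mul_one, mul_div_cancel₀ _ hden.ne', ← hp₁p]
    ring
  have hΛ1 : 1 ≤ Real.log (1 / ε) := by
    rw [Real.le_log_iff_exp_le (by positivity), le_div_iff₀ h0]
    nlinarith [Real.exp_one_lt_d9, Real.exp_pos 1]
  have hK0 : 0 ≤ K := by positivity
  -- The separator must be small compared with `L`, as a balanced bag requires `4k ≤ |L|`.
  have hKle : K ≤ ε * n / 1000 := by
    have h2 : ε ^ 3 / Real.log (1 / ε) ≤ ε ^ 3 := div_le_self (by positivity) hΛ1
    have h3 : ε ^ 3 ≤ ε := by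
      have : ε ^ 3 ≤ ε ^ 1 := pow_le_pow_of_le_one h0.le (by linarith) (by norm_num)
      simpa using this
    have h4 : K ≤ 1 / 10 ^ 6 * ε * n := by
      rw [hK]
      gcongr
      exact h2.trans h3
    linarith
  set k := ⌊K + 1⌋₊ with hk
  have hkK : (k : ℝ) ≤ K + 1 := Nat.floor_le (by positivity)
  set l := ⌊ε * n / 4⌋₊ - ⌈ε * n / 8⌉₊ with hl
  have hlow : ε * n / 9 ≤ (l : ℝ) := by
    have h2 := Nat.lt_floor_add_one (ε * n / 4)
    have h3 := Nat.ceil_lt_add_one (show 0 ≤ ε * n / 8 by positivity)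
    have h4 : (⌊ε * n / 4⌋₊ : ℝ) ≤ l + ⌈ε * n / 8⌉₊ := by
      norm_cast
      omega
    linarith
  have hkl : 4 * k ≤ l := by
    have : 4 * (k : ℝ) ≤ l := by linarith
    exact_mod_cast this
  have hsub : {G : SimpleGraph (Fin n) | K ≤ (treeWidth G : ℝ)}ᶜ ⊆
      {G | ∀ L : Finset (Fin n), l ≤ L.card → HasBalancedSeparation G k L} := by
    intro G hG L hL
    simp only [Set.mem_compl_iff, Set.mem_ofPred_eq, not_le] at hG
    obtain ⟨D, hD⟩ := exists_treeDecomposition_card_bag_le G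
    refine D.exists_balanced_separator (fun x => Nat.le_floor ?_) L (hkl.trans hL)
    have : ((D.bag x).card : ℝ) ≤ treeWidth G + 1 := by exact_mod_cast hD x
    linarith
  refine (measureReal_mono hsub (measure_ne_top _ _)).trans
    ((binomialRandom_forall_hasBalancedSeparation_le (p₁ := ⟨_, hp₁⟩) (p₂ := ⟨_, hp₂⟩)
      hsplit k l).trans (add_le_add ?_ ?_))
  · exact binomialRandom_no_linear_component_le h0 (by linarith) hn0 rfl
  · refine sum_pow_mul_exp_le h0 h1 hn0 rfl ?_ hlow hkK
    refine le_div_self (by positivity) hden ?_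
    have : 0 ≤ (1 + ε / 2) / (n : ℝ) := by positivity
    linarith

end SimpleGraph

/-! ### Passage to the limit. -/

open MeasureTheory in
/-- There are absolute constants `c, ε₀ > 0` such that for every fixed `0 < ε < ε₀`, if
`p = (1 + ε) / n` then `tw(G(n, p)) ≥ c * ε ^ 3 / log (1 / ε) * n` with probability tending to one
as `n → ∞`. The edge probability only has to be `(1 + ε) / n` for all large `n`, as this number is
not a probability for `n ≤ 1`. -/
theorem theorem1p5 :
    ∃ c : ℝ, 0 < c ∧ ∃ ε₀ : ℝ, 0 < ε₀ ∧ ε₀ < 1 ∧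
      ∀ ε : ℝ, 0 < ε → ε < ε₀ →
        ∀ p : ℕ → unitInterval, (∀ᶠ n : ℕ in atTop, (p n : ℝ) = (1 + ε) / (n : ℝ)) →
          Tendsto
            (fun n : ℕ => SimpleGraph.binomialRandom (Fin n) (p n)
              {G : SimpleGraph (Fin n) |
                c * (ε ^ 3 / Real.log (1 / ε)) * (n : ℝ) ≤ (treeWidth G : ℝ)})
            atTop (𝓝 1) := by
  refine ⟨1 / 10 ^ 6, by norm_num, 1 / 10 ^ 6, by norm_num, by norm_num, fun ε h0 h1 p hp => ?_⟩
  set S : ∀ n : ℕ, Set (SimpleGraph (Fin n)) := fun n =>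
    {G | 1 / 10 ^ 6 * (ε ^ 3 / Real.log (1 / ε)) * (n : ℝ) ≤ (treeWidth G : ℝ)}
  have hbound : ∀ᶠ n : ℕ in atTop, (SimpleGraph.binomialRandom (Fin n) (p n)).real (S n)ᶜ ≤
      n * Real.exp (-(ε ^ 3 / 4096 * n)) +
        Real.exp (6 * Real.log (1 / ε)) * Real.exp (-(ε ^ 3 / 20000 * n)) := by
    have hlarge : ∀ᶠ n : ℕ in atTop, 1000 ≤ ε * n :=
      (tendsto_natCast_atTop_atTop.const_mul_atTop h0).eventually_ge_atTop 1000
    filter_upwards [hp, hlarge] with n hpn hn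
    exact SimpleGraph.binomialRandom_treeWidth_lt_le h0 h1.le hn hpn
  have hexp : ∀ d : ℝ, 0 < d → ∀ j : ℕ,
      Tendsto (fun n : ℕ => (n : ℝ) ^ j * Real.exp (-(d * n))) atTop (𝓝 0) := by
    intro d hd j
    have := (Real.tendsto_pow_mul_exp_neg_atTop_nhds_zero j).comp
      (tendsto_natCast_atTop_atTop.const_mul_atTop hd)
    have h := this.const_mul (d ^ j)⁻¹
    rw [mul_zero] at h
    refine h.congr fun n => ?_
    simp only [Function.comp_apply, mul_pow]
    field_simp
  have hlim : Tendsto (fun n : ℕ => (n : ℝ) * Real.exp (-(ε ^ 3 / 4096 * n)) +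
      Real.exp (6 * Real.log (1 / ε)) * Real.exp (-(ε ^ 3 / 20000 * n))) atTop (𝓝 0) := by
    have ha := hexp (ε ^ 3 / 4096) (by positivity) 1
    have hb := (hexp (ε ^ 3 / 20000) (by positivity) 0).const_mul
      (Real.exp (6 * Real.log (1 / ε)))
    simpa using ha.add hb
  have hcompl : Tendsto (fun n : ℕ => (SimpleGraph.binomialRandom (Fin n) (p n)).real (S n)ᶜ)
      atTop (𝓝 0) :=
    squeeze_zero' (.of_forall fun _ => measureReal_nonneg) hbound hlim
  have hreal : Tendsto (fun n : ℕ => (SimpleGraph.binomialRandom (Fin n) (p n)).real (S n))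
      atTop (𝓝 1) := by
    have h := hcompl.const_sub 1
    rw [sub_zero] at h
    refine h.congr fun n => ?_
    rw [probReal_compl_eq_one_sub .of_discrete, sub_sub_cancel]
  have h := ENNReal.tendsto_ofReal hreal
  rw [ENNReal.ofReal_one] at h
  exact h.congr fun n => ofReal_measureReal
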